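/- All linear orders below are countable. For linear orders with finite tuples, $\le_\alpha$ denotes the standard back-and-forth relation: $(A,\bar a)\le_0(B,\bar b)$ iff $\bar a$ and $\bar b$ satisfy the same atomic formulas, and for $\alpha>0$, $(A,\bar a)\le_\alpha(B,\bar b)$ iff for every $\beta<\alpha$ and every finite tuple $\bar d$ in $B$ there is a tuple $\bar c$ in $A$ with $(B,\bar b\bar d)\le_\beta(A,\bar a\bar c)$; $A\equiv_\alpha B$ means $A\le_\alpha B$ and $B\le_\alpha A$. The Scott rank $SR(A)$ is the least $\alpha$ such that $A$ has a $\Pi_{\alpha+1}$ Scott sentence in $\mathcal L_{\omega_1\omega}$, that is, a $\Pi_{\alpha+1}$ sentence whose countable models are exactly the isomorphic copies of $A$. Let $\lambda$ be a limit ordinal. A pair $(\{L_i\}_{i\in\omega},K)$ of a sequence of linear orders and a nonempty linear order $K$ is a $\lambda$-mixable pair, with associated fundamental sequence $\delta_0<\delta_1<\cdots\to\lambda$ of non-zero ordinals, if 1. $SR(K)<\lambda$; 2. $SR(L_i)<\lambda$ for all $i$; 3. $L_i\equiv_{\delta_i}L_{i+1}$ for all $i$; 4. $L_i\not\equiv_{\delta_{i+1}}L_{i+1}$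 for all $i$; 5. in every finite alternating sum $1+L_{a_0}+1+K+1+L_{a_1}+1+K+\cdots+1+L_{a_n}$, every open interval $(a,b)$ isomorphic to $K$ is contained in one of the written $K$ blocks. A limit structure of the pair is a countable linear order $N$ such that for every $n$ there is an $i\ge n$ with $N\equiv_{\delta_n}L_i$. For $f\colon\mathbb Z\to\mathbb N\cup\{\infty\}$, an $(f,\mathbb Z)$-sum of the pair is a linear order isomorphic to one of the form $\sum_{n\in\mathbb Z}(1+M_n+1+K)$, where $M_n\cong L_{f(n)}$ if $f(n)<\infty$, and $M_n$ is some limit structure, possibly different for each such $n$, if $f(n)=\infty$. The function $f$ is almost periodic if it is not periodic but $\min(\ell,f)$ is periodic for every $\ell\in\mathbb N$. Write $f\mathrel{E_{\mathrm{fin}}}g$ if for every $\ell\in\mathbb N$ there is an $n\in\mathbb Z$ with $\min(\ell,f(m))=\min(\ell,g(m+n))$ for all $m\in\mathbb Z$. **Proposition.** Fix a $\lambda$-mixable pair, with its associated fundamental sequence, and let $f,g\colon\mathbb Z\to\mathbb N\cup\{\infty\}$ be almost periodic. Let $L_f$ be any $(f,\mathbb Z)$-sum and $L_g$ any $(g,\mathbb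 Z)$-sum of the pair. Then $$L_f\equiv_\lambda L_g\quad\Longleftrightarrow\quad f\mathrel{E_{\mathrm{fin}}}g .$$ -/

import Mathlib

open FirstOrder

namespace ZSumTransfer

/-! ## Back-and-forth relations between linear orders -/

/-- The standard (asymmetric) back-and-forth relation `(M, a) ≤_α (N, b)` on linear orders with
distinguished tuples: at `α = 0` the tuples satisfy the same atomic formulas, and for `α > 0`,
for all `β < α` and every finite tuple `d` of `N` there is a tuple `c` of `M` of the same length
with `(N, b d) ≤_β (M, a c)`.
(For `α > 0` the first conjunct is implied by the second one, with `β = 0` and `k = 0`.) -/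
def BFLE (α : Ordinal.{0}) {M N : Type} [LinearOrder M] [LinearOrder N] {n : ℕ}
    (a : Fin n → M) (b : Fin n → N) : Prop :=
  (∀ i j, a i ≤ a j ↔ b i ≤ b j) ∧
    ∀ β, β < α → ∀ (k : ℕ) (d : Fin k → N), ∃ c : Fin k → M,
      BFLE β (Fin.append b d) (Fin.append a c)
termination_by α

/-- `M ≡_α N`: both `M ≤_α N` and `N ≤_α M`, with empty tuples. -/
def BFEquiv (α : Ordinal.{0}) (M N : Type) [LinearOrder M] [LinearOrder N] : Prop :=
  BFLE α (Fin.elim0 : Fin 0 → M) (Fin.elim0 : Fin 0 → N) ∧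
    BFLE α (Fin.elim0 : Fin 0 → N) (Fin.elim0 : Fin 0 → M)

/-! ## The infinitary logic `L_{ω₁ω}` of orders, its complexity classes, and Scott rank -/

/-- Formulas of `L_{ω₁ω}` in the language of orders, in the usual normal form, with free variables
among `x_0, …, x_{n-1}`: finitary quantifier-free formulas, countable disjunctions
`⋁_i ∃ ȳ_i φ_i` and countable conjunctions `⋀_i ∀ ȳ_i φ_i`, where `ȳ_i` is a tuple of new variables
of finite (possibly zero) length `k i`. -/
inductive InfFormula : ℕ → Type
  | qf {n : ℕ} (φ : Language.order.BoundedFormula Empty n) (hφ : φ.IsQF) : InfFormula n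
  | disjEx {n : ℕ} (k : ℕ → ℕ) (φ : ∀ i, InfFormula (n + k i)) : InfFormula n
  | conjAll {n : ℕ} (k : ℕ → ℕ) (φ : ∀ i, InfFormula (n + k i)) : InfFormula n

/-- Satisfaction of an infinitary formula by a tuple of a linear order. -/
def InfFormula.Realize {M : Type} [LinearOrder M] : {n : ℕ} → InfFormula n → (Fin n → M) → Prop
  | _, .qf φ _, v =>
      letI : Language.order.Structure M := Language.orderStructure M
      φ.Realize Empty.elim v
  | _, .disjEx k φ, v => ∃ i, ∃ w : Fin (k i) → M, (φ i).Realize (Fin.append v w)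
  | _, .conjAll k φ, v => ∀ i, ∀ w : Fin (k i) → M, (φ i).Realize (Fin.append v w)

/-- The two sides of the infinitary hierarchy. -/
inductive Side : Type
  | sigma
  | pi

/-- `φ.HasComplexity .sigma α` says that `φ` is `Σ_α`, and `φ.HasComplexity .pi α` that `φ` is
`Π_α`. Quantifier-free formulas are `Σ_0` and `Π_0` (hence count at every level); for `α > 0` a
`Σ_α` formula is a countable disjunction of formulas `∃ ȳ φ_i` with each `φ_i` being `Π_β` for
some `β < α`, and dually for `Π_α`. -/
def InfFormula.HasComplexity : {n : ℕ} → InfFormula n → Side → Ordinal.{0} → Prop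
  | _, .qf _ _, _, _ => True
  | _, .disjEx _ φ, .sigma, α => ∀ i, ∃ β, β < α ∧ (φ i).HasComplexity .pi β
  | _, .conjAll _ φ, .pi, α => ∀ i, ∃ β, β < α ∧ (φ i).HasComplexity .sigma β
  | _, .disjEx _ _, .pi, _ => False
  | _, .conjAll _ _, .sigma, _ => False

/-- `φ` is a Scott sentence of `M`: its countable models are exactly the isomorphic copies
of `M`. -/
def IsScottSentence (φ : InfFormula 0) (M : Type) [LinearOrder M] : Prop :=
  ∀ (N : Type) [LinearOrder N] [Countable N],
    φ.Realize (Fin.elim0 : Fin 0 → N) ↔ Nonempty (N ≃o M)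

/-- `SR(M) < lam`, where `SR(M)` is the least `α` such that `M` has a `Π_{α+1}` Scott sentence. -/
def ScottRankLT (M : Type) [LinearOrder M] (lam : Ordinal.{0}) : Prop :=
  ∃ α, α < lam ∧ ∃ φ : InfFormula 0, φ.HasComplexity .pi (α + 1) ∧ IsScottSentence φ M

/-! ## Sums -/

/-- The linear order `1 + M + 1 + K`. -/
abbrev Block (M K : Type) : Type := Unit ⊕ₗ (M ⊕ₗ (Unit ⊕ₗ K))

/-- The linear order `∑_{n ∈ ℤ} (1 + M n + 1 + K)`. -/
abbrev ZSum (M : ℤ → Type) (K : Type) : Type := Σₗ n : ℤ, Block (M n) K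

/-- The finite alternating sum `1 + M 0 + 1 + K + 1 + M 1 + 1 + K + ⋯ + 1 + M n`. -/
abbrev FinSum (M : ℕ → Type) (K : Type) (n : ℕ) : Type :=
  (Σₗ j : Fin n, Block (M j) K) ⊕ₗ (Unit ⊕ₗ M n)

/-- The `j`-th written `K` block of a finite alternating sum. -/
def FinSum.kBlock (M : ℕ → Type) (K : Type) (n : ℕ) (j : Fin n) : Set (FinSum M K n) :=
  Set.range fun x : K =>
    Sum.inlₗ (toLex ⟨j, Sum.inrₗ (Sum.inrₗ (Sum.inrₗ x))⟩)

/-! ## Mixable pairs, limit structures and `(f, ℤ)`-sums -/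

/-- `δ` is a fundamental sequence for `lam` with non-zero terms. -/
structure IsFundamentalSeq (δ : ℕ → Ordinal.{0}) (lam : Ordinal.{0}) : Prop where
  ne_zero : ∀ i, δ i ≠ 0
  strictMono : StrictMono δ
  isLUB : IsLUB (Set.range δ) lam

/-- `(L, K)` is a `lam`-mixable pair, as witnessed by the fundamental sequence `δ`. -/
structure IsMixablePair (lam : Ordinal.{0}) (δ : ℕ → Ordinal.{0}) (L : ℕ → Type) (K : Type)
    [∀ i, LinearOrder (L i)] [LinearOrder K] : Prop where
  isSuccLimit : Order.IsSuccLimit lam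
  fundamental : IsFundamentalSeq δ lam
  countable_seq : ∀ i, Countable (L i)
  countable_delim : Countable K
  nonempty_delim : Nonempty K
  rank_delim : ScottRankLT K lam
  rank_seq : ∀ i, ScottRankLT (L i) lam
  equiv_succ : ∀ i, BFEquiv (δ i) (L i) (L (i + 1))
  not_equiv_succ : ∀ i, ¬ BFEquiv (δ (i + 1)) (L i) (L (i + 1))
  delim : ∀ (n : ℕ) (s : ℕ → ℕ) (a b : FinSum (fun j => L (s j)) K n),
    Nonempty (Set.Ioo a b ≃o K) →
      ∃ j : Fin n, Set.Ioo a b ⊆ FinSum.kBlock (fun j => L (s j)) K n j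

/-- `N` is a limit structure of the sequence `L` (with respect to `δ`). -/
def IsLimitStructure (δ : ℕ → Ordinal.{0}) (L : ℕ → Type) [∀ i, LinearOrder (L i)]
    (N : Type) [LinearOrder N] : Prop :=
  Countable N ∧ ∀ n, ∃ i, n ≤ i ∧ BFEquiv (δ n) N (L i)

/-- `S` is an `(f, ℤ)`-sum of the pair `(L, K)`: it is isomorphic to `∑_{n ∈ ℤ} (1 + M n + 1 + K)`
where `M n` is (a copy of) `L (f n)` if `f n` is finite and some limit structure if `f n = ∞`. -/
def IsZSum (δ : ℕ → Ordinal.{0}) (L : ℕ → Type) (K : Type)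
    [∀ i, LinearOrder (L i)] [LinearOrder K] (f : ℤ → ℕ∞) (S : Type) [LinearOrder S] : Prop :=
  ∃ (M : ℤ → Type) (_ : ∀ n, LinearOrder (M n)),
    (∀ n, ∀ i : ℕ, f n = (i : ℕ∞) → Nonempty (M n ≃o L i)) ∧
    (∀ n, f n = ⊤ → IsLimitStructure δ L (M n)) ∧
    Nonempty (S ≃o ZSum M K)

/-! ## Almost periodic functions -/

/-- The truncation `min(ℓ, f)`. -/
noncomputable def trunc (ℓ : ℕ) (f : ℤ → ℕ∞) : ℤ → ℕ∞ := fun m => min (ℓ : ℕ∞) (f m)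

/-- `f` has some period `p > 0`. -/
def IsPeriodic (f : ℤ → ℕ∞) : Prop := ∃ p : ℤ, 0 < p ∧ Function.Periodic f p

/-- `f` is not periodic, but all its truncations are. -/
def AlmostPeriodic (f : ℤ → ℕ∞) : Prop := ¬ IsPeriodic f ∧ ∀ ℓ : ℕ, IsPeriodic (trunc ℓ f)

/-- Shift equivalence of functions on `ℤ`. -/
def ShiftEquiv (f g : ℤ → ℕ∞) : Prop := ∃ n : ℤ, ∀ m : ℤ, f m = g (m + n)

/-- `f E_fin g`: all truncations are shift equivalent. -/
def EFin (f g : ℤ → ℕ∞) : Prop := ∀ ℓ : ℕ, ShiftEquiv (trunc ℓ f) (trunc ℓ g)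

end ZSumTransfer

namespace ZSumTransfer

/-! ## Basic properties of the back-and-forth relations -/

section Basic

variable {M N P : Type} [LinearOrder M] [LinearOrder N] [LinearOrder P]

/-! From right to left: for each `l`, all `L i` with `i ≥ l`, and all limit structures, lie in one
`≡_{δ l}`-class. Ordered sums preserve `≡`, so an `(f, ℤ)`-sum is `≡_{δ l}` to the sum for `min(l,
f)` (`IsZSum.bfEquiv_trunc`). If the truncations at `l` are shifts of each other, the two sums are
therefore `≡_{δ l}`. As the `δ l` are cofinal in `lam`, having this for every `l` gives `≡_lam`.

From left to right: fix `l` and replace both sums by their truncations at a large `N`, so that only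
copies of the `L i` occur and the delimiter condition applies. Since `K` has a Scott sentence of
complexity below `lam`, a back-and-forth relation of suitable level below `lam` recognises the `K`
blocks: endpoints of consecutive `K` blocks must be answered by endpoints of consecutive `K` blocks
(`IsMarked.exists_shift`). The intervals between them are then `≡_{δ l}`, which determines the
indices up to truncation at `l` (`IsMixablePair.min_eq_of_bfEquiv`). So the truncations at `l`
agree, up to a shift, on arbitrarily long finite windows. A window as long as a common period
suffices. -/

theorem bfle_iff {α : Ordinal.{0}} {n : ℕ} {a : Fin n → M} {b : Fin n → N} :
    BFLE α a b ↔ (∀ i j, a i ≤ a j ↔ b i ≤ b j) ∧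
      ∀ β, β < α → ∀ (k : ℕ) (d : Fin k → N), ∃ c : Fin k → M,
        BFLE β (Fin.append b d) (Fin.append a c) := by
  rw [BFLE]

theorem BFLE.le_iff_le {α : Ordinal.{0}} {n : ℕ} {a : Fin n → M} {b : Fin n → N}
    (h : BFLE α a b) (i j : Fin n) : a i ≤ a j ↔ b i ≤ b j :=
  (bfle_iff.1 h).1 i j

theorem BFLE.lt_iff_lt {α : Ordinal.{0}} {n : ℕ} {a : Fin n → M} {b : Fin n → N}
    (h : BFLE α a b) (i j : Fin n) : a i < a j ↔ b i < b j := by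
  rw [← not_le, ← not_le, h.le_iff_le]

theorem BFLE.exists_extend {α β : Ordinal.{0}} {n : ℕ} {a : Fin n → M} {b : Fin n → N}
    (h : BFLE α a b) (hβ : β < α) {k : ℕ} (d : Fin k → N) :
    ∃ c : Fin k → M, BFLE β (Fin.append b d) (Fin.append a c) :=
  (bfle_iff.1 h).2 β hβ k d

theorem BFLE.mono {α β : Ordinal.{0}} {n : ℕ} {a : Fin n → M} {b : Fin n → N}
    (h : BFLE α a b) (hβ : β ≤ α) : BFLE β a b :=
  bfle_iff.2 ⟨h.le_iff_le, fun _ hγ _ d => h.exists_extend (hγ.trans_le hβ) d⟩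

theorem BFLE.comp {α : Ordinal.{0}} {M N : Type} [LinearOrder M] [LinearOrder N]
    {n m : ℕ} {a : Fin n → M} {b : Fin n → N}
    (h : BFLE α a b) (σ : Fin m → Fin n) : BFLE α (a ∘ σ) (b ∘ σ) := by
  induction α using WellFoundedLT.induction generalizing M N n m with
  | ind α ih =>
    refine bfle_iff.2 ⟨fun i j => h.le_iff_le _ _, fun β hβ k d => ?_⟩
    obtain ⟨c, hc⟩ := h.exists_extend hβ d
    refine ⟨c, ?_⟩
    have := ih β hβ hc (Fin.append (Fin.castAdd k ∘ σ) (Fin.natAdd n))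
    convert this using 1 <;>
    · ext t
      refine Fin.addCases (fun t => ?_) (fun t => ?_) t <;> simp

/-- Playing the empty tuple swaps the two sides, at the cost of a smaller ordinal. -/
theorem BFLE.symm_of_lt {α β : Ordinal.{0}} {n : ℕ} {a : Fin n → M} {b : Fin n → N}
    (h : BFLE α a b) (hβ : β < α) : BFLE β b a := by
  obtain ⟨c, hc⟩ := h.exists_extend hβ (Fin.elim0 : Fin 0 → N)
  have := hc.comp (Fin.castAdd 0)
  convert this using 1 <;>
  · ext t
    exact (Fin.append_left _ _ t).symm

theorem BFLE.trans {α : Ordinal.{0}} {M N P : Type} [LinearOrder M] [LinearOrder N]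
    [LinearOrder P] {n : ℕ} {a : Fin n → M} {b : Fin n → N} {c : Fin n → P}
    (h : BFLE α a b) (h' : BFLE α b c) : BFLE α a c := by
  induction α using WellFoundedLT.induction generalizing M N P n with
  | ind α ih =>
    refine bfle_iff.2 ⟨fun i j => (h.le_iff_le i j).trans (h'.le_iff_le i j),
      fun β hβ k d => ?_⟩
    obtain ⟨e, he⟩ := h'.exists_extend hβ d
    obtain ⟨f, hf⟩ := h.exists_extend hβ e
    exact ⟨f, ih β hβ he hf⟩

theorem bfle_orderIso {α : Ordinal.{0}} {M N : Type} [LinearOrder M] [LinearOrder N]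
    (e : M ≃o N) {n : ℕ} (a : Fin n → M) : BFLE α a (e ∘ a) := by
  induction α using WellFoundedLT.induction generalizing M N n with
  | ind α ih =>
    refine bfle_iff.2 ⟨fun i j => by simp, fun β hβ k d => ⟨e.symm ∘ d, ?_⟩⟩
    have := ih β hβ e.symm (Fin.append (e ∘ a) d)
    convert this using 1
    ext t
    refine Fin.addCases (fun t => ?_) (fun t => ?_) t <;> simp

theorem BFEquiv.symm {α : Ordinal.{0}} (h : BFEquiv α M N) : BFEquiv α N M := ⟨h.2, h.1⟩

theorem BFEquiv.trans {α : Ordinal.{0}} (h : BFEquiv α M N) (h' : BFEquiv α N P) :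
    BFEquiv α M P := ⟨h.1.trans h'.1, h'.2.trans h.2⟩

theorem BFEquiv.mono {α β : Ordinal.{0}} (h : BFEquiv α M N) (hβ : β ≤ α) : BFEquiv β M N :=
  ⟨h.1.mono hβ, h.2.mono hβ⟩

theorem BFEquiv.of_orderIso {α : Ordinal.{0}} (e : M ≃o N) : BFEquiv α M N := by
  constructor
  · convert bfle_orderIso e Fin.elim0
  · convert bfle_orderIso e.symm Fin.elim0

theorem BFEquiv.refl (α : Ordinal.{0}) (M : Type) [LinearOrder M] : BFEquiv α M M :=
  .of_orderIso (.refl M)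

/-- Restriction to the open interval between two distinguished points. -/
theorem BFLE.restrict_Ioo {α : Ordinal.{0}} {M N : Type} [LinearOrder M] [LinearOrder N]
    {n : ℕ} {a : Fin n → M} {b : Fin n → N} (h : BFLE α a b) (i j : Fin n) {m : ℕ}
    (x : Fin m → Set.Ioo (a i) (a j)) (y : Fin m → Set.Ioo (b i) (b j)) (σ : Fin m → Fin n)
    (hx : ∀ t, (x t : M) = a (σ t)) (hy : ∀ t, (y t : N) = b (σ t)) : BFLE α x y := by
  induction α using WellFoundedLT.induction generalizing M N n m with
  | ind α ih =>
    refine bfle_iff.2 ⟨fun s t => ?_, fun β hβ k d => ?_⟩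
    · rw [← Subtype.coe_le_coe, ← Subtype.coe_le_coe, hx, hx, hy, hy, h.le_iff_le]
    obtain ⟨c, hc⟩ := h.exists_extend hβ fun t => (d t : N)
    -- The answers preserve the order relative to the endpoints, so they fall in the corresponding
    -- interval.
    have hmem : ∀ t, c t ∈ Set.Ioo (a i) (a j) := fun t => by
      have h1 := hc.lt_iff_lt (Fin.castAdd k i) (Fin.natAdd n t)
      have h2 := hc.lt_iff_lt (Fin.natAdd n t) (Fin.castAdd k j)
      simp only [Fin.append_left, Fin.append_right] at h1 h2
      exact ⟨h1.1 (d t).2.1, h2.1 (d t).2.2⟩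
    refine ⟨fun t => ⟨c t, hmem t⟩, ?_⟩
    -- The endpoints of the extended tuples are only propositionally equal to the old ones.
    -- Generalising over them avoids transport between the interval types.
    have key : ∀ (b' : N) (b'' : N) (a' : M) (a'' : M)
        (hb' : b' = Fin.append b (fun t => (d t : N)) (Fin.castAdd k i))
        (hb'' : b'' = Fin.append b (fun t => (d t : N)) (Fin.castAdd k j))
        (ha' : a' = Fin.append a c (Fin.castAdd k i))
        (ha'' : a'' = Fin.append a c (Fin.castAdd k j))
        (y' : Fin (m + k) → Set.Ioo b' b'') (x' : Fin (m + k) → Set.Ioo a' a''),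
        (∀ t, (y' t : N) = Fin.append b (fun t => (d t : N))
          (Fin.append (Fin.castAdd k ∘ σ) (Fin.natAdd n) t)) →
        (∀ t, (x' t : M) = Fin.append a c
          (Fin.append (Fin.castAdd k ∘ σ) (Fin.natAdd n) t)) → BFLE β y' x' := by
      rintro _ _ _ _ rfl rfl rfl rfl y' x' h1 h2
      exact ih β hβ hc _ _ y' x' _ h1 h2
    refine key _ _ _ _ (by simp) (by simp) (by simp) (by simp) _ _ (fun t => ?_) fun t => ?_ <;>
    refine Fin.addCases (fun t => ?_) (fun t => ?_) t <;> simp [hx, hy]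

theorem BFLE.Ioo {α : Ordinal.{0}} {n : ℕ} {a : Fin n → M} {b : Fin n → N} (h : BFLE α a b)
    {i j : Fin n} {x x' : M} {y y' : N} (hx : a i = x) (hx' : a j = x') (hy : b i = y)
    (hy' : b j = y') : BFLE α (Fin.elim0 : Fin 0 → Set.Ioo x x')
      (Fin.elim0 : Fin 0 → Set.Ioo y y') := by
  subst hx hx' hy hy'
  exact h.restrict_Ioo i j _ _ Fin.elim0 (fun t => t.elim0) (fun t => t.elim0)

end Basic

/-! ## Sums -/

/-- The maps `u i` exhibit `S` as the ordered sum of the linear orders `A i`. -/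
structure IsOrderedSum {I : Type} [LinearOrder I] {A : I → Type} [∀ i, LinearOrder (A i)]
    {S : Type} [LinearOrder S] (u : ∀ i, A i → S) : Prop where
  strictMono : ∀ i, StrictMono (u i)
  lt : ∀ i j, i < j → ∀ x y, u i x < u j y
  exists_eq : ∀ s, ∃ i x, s = u i x

theorem IsOrderedSum.le_iff_le {I : Type} [LinearOrder I] {A B : I → Type}
    [∀ i, LinearOrder (A i)] [∀ i, LinearOrder (B i)] {S T : Type} [LinearOrder S]
    [LinearOrder T] {u : ∀ i, A i → S} {v : ∀ i, B i → T} (hu : IsOrderedSum u)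
    (hv : IsOrderedSum v) {i j : I} {x : A i} {x' : A j} {y : B i} {y' : B j}
    (h : ∀ e : i = j, e ▸ x ≤ x' ↔ e ▸ y ≤ y') : u i x ≤ u j x' ↔ v i y ≤ v j y' := by
  rcases lt_trichotomy i j with hij | rfl | hij
  · simp [(hu.lt _ _ hij x x').le, (hv.lt _ _ hij y y').le]
  · simpa [(hu.strictMono i).le_iff_le, (hv.strictMono i).le_iff_le] using h rfl
  · exact iff_of_false (hu.lt _ _ hij x' x).not_ge (hv.lt _ _ hij y' y).not_ge

/-- A challenge in the sum is answered separately inside each summand. The tuples `x i`, `y i`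
record the positions reached so far in the summands, which is what makes the induction on `α` go
through. -/
theorem IsOrderedSum.bfle {α : Ordinal.{0}} {I : Type} [LinearOrder I] {A B : I → Type}
    [∀ i, LinearOrder (A i)] [∀ i, LinearOrder (B i)] {S T : Type} [LinearOrder S]
    [LinearOrder T] {u : ∀ i, A i → S} {v : ∀ i, B i → T} (hu : IsOrderedSum u)
    (hv : IsOrderedSum v) (m : I → ℕ) (x : ∀ i, Fin (m i) → A i) (y : ∀ i, Fin (m i) → B i)
    (h : ∀ i, BFLE α (x i) (y i)) {n : ℕ} (a : Fin n → S) (b : Fin n → T)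
    (hab : ∀ t, ∃ i q, a t = u i (x i q) ∧ b t = v i (y i q)) : BFLE α a b := by
  induction α using WellFoundedLT.induction generalizing A B S T n m with
  | ind α ih =>
    refine bfle_iff.2 ⟨fun s t => ?_, fun β hβ k d => ?_⟩
    · obtain ⟨i, q, h1, h2⟩ := hab s
      obtain ⟨j, r, h3, h4⟩ := hab t
      rw [h1, h2, h3, h4]
      refine hu.le_iff_le hv fun e => ?_
      subst e
      exact (h i).le_iff_le q r
    -- `ι t` is the summand containing `d t`. The entries falling in summand `i`, enumerated by `e
    -- i`, form the challenge there, which is empty for all but finitely many `i`.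
    choose ι z hz using fun t => hv.exists_eq (d t)
    classical
    let e : ∀ i, {t // ι t = i} ≃ Fin (Fintype.card {t // ι t = i}) :=
      fun i => Fintype.equivFin _
    choose c hc using fun i => (h i).exists_extend hβ
      fun q : Fin (Fintype.card {t // ι t = i}) =>
        ((e i).symm q).2 ▸ z ((e i).symm q).1
    refine ⟨fun t => u (ι t) (c (ι t) (e (ι t) ⟨t, rfl⟩)),
      ih β hβ hv hu _ _ _ hc _ _ fun t => ?_⟩
    refine Fin.addCases (fun t => ?_) (fun t => ?_) t
    · obtain ⟨i, q, h1, h2⟩ := hab t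
      exact ⟨i, Fin.castAdd _ q, by simp [h2], by simp [h1]⟩
    · refine ⟨ι t, Fin.natAdd _ (e (ι t) ⟨t, rfl⟩), ?_, by simp⟩
      simp only [Fin.append_right]
      rw [hz t]
      congr 1
      generalize hw : (e (ι t)).symm (e (ι t) ⟨t, rfl⟩) = w
      rw [Equiv.symm_apply_apply] at hw
      subst hw
      rfl

theorem IsOrderedSum.bfEquiv {α : Ordinal.{0}} {I : Type} [LinearOrder I] {A B : I → Type}
    [∀ i, LinearOrder (A i)] [∀ i, LinearOrder (B i)] {S T : Type} [LinearOrder S]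
    [LinearOrder T] {u : ∀ i, A i → S} {v : ∀ i, B i → T} (hu : IsOrderedSum u)
    (hv : IsOrderedSum v) (h : ∀ i, BFEquiv α (A i) (B i)) : BFEquiv α S T :=
  ⟨hu.bfle hv (fun _ => 0) _ _ (fun i => (h i).1) _ _ fun t => t.elim0,
    hv.bfle hu (fun _ => 0) _ _ (fun i => (h i).2) _ _ fun t => t.elim0⟩

theorem isOrderedSum_sigma {I : Type} [LinearOrder I] (A : I → Type)
    [∀ i, LinearOrder (A i)] :
    IsOrderedSum (S := Σₗ i, A i) fun i (x : A i) => toLex ⟨i, x⟩ where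
  strictMono _ _ _ h := Sigma.Lex.right _ _ h
  lt _ _ h _ _ := Sigma.Lex.left _ _ h
  exists_eq s := ⟨(ofLex s).1, (ofLex s).2, rfl⟩

theorem BFEquiv.sigma {α : Ordinal.{0}} {I : Type} [LinearOrder I] {A B : I → Type}
    [∀ i, LinearOrder (A i)] [∀ i, LinearOrder (B i)] (h : ∀ i, BFEquiv α (A i) (B i)) :
    BFEquiv α (Σₗ i, A i) (Σₗ i, B i) :=
  (isOrderedSum_sigma A).bfEquiv (isOrderedSum_sigma B) h

/-- The two-element family with members `A` and `B`. -/
abbrev BoolFamily (A B : Type) : Bool → Type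
  | false => A
  | true => B

instance (A B : Type) [LinearOrder A] [LinearOrder B] : ∀ i, LinearOrder (BoolFamily A B i)
  | false => inferInstanceAs (LinearOrder A)
  | true => inferInstanceAs (LinearOrder B)

theorem isOrderedSum_sum (A B : Type) [LinearOrder A] [LinearOrder B] :
    IsOrderedSum (A := BoolFamily A B) (S := A ⊕ₗ B)
      (fun | false => Sum.inlₗ | true => Sum.inrₗ) where
  strictMono
    | false => Sum.Lex.inl_strictMono
    | true => Sum.Lex.inr_strictMono
  lt
    | false, true, _, x, y => Sum.Lex.inl_lt_inr x y
  exists_eq s := by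
    rcases s with x | x
    · exact ⟨false, x, rfl⟩
    · exact ⟨true, x, rfl⟩

theorem BFEquiv.sumLex {α : Ordinal.{0}} {A B A' B' : Type} [LinearOrder A] [LinearOrder B]
    [LinearOrder A'] [LinearOrder B'] (h : BFEquiv α A A') (h' : BFEquiv α B B') :
    BFEquiv α (A ⊕ₗ B) (A' ⊕ₗ B') :=
  (isOrderedSum_sum A B).bfEquiv (isOrderedSum_sum A' B') (Bool.forall_bool.2 ⟨h, h'⟩)

/-- Relabelling the summands by a translation of `ℤ` turns a shift of functions into a comparison
summand by summand. -/
theorem isOrderedSum_sigma_add (A : ℤ → Type) [∀ i, LinearOrder (A i)] (s : ℤ) :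
    IsOrderedSum (A := fun i => A (i + s)) (S := Σₗ i, A i)
      fun i (x : A (i + s)) => toLex ⟨i + s, x⟩ where
  strictMono _ _ _ h := Sigma.Lex.right _ _ h
  lt _ _ h _ _ := Sigma.Lex.left _ _ (add_lt_add_left h s)
  exists_eq := by
    rintro ⟨n, x⟩
    obtain ⟨i, rfl⟩ : ∃ i, i + s = n := ⟨n - s, by simp⟩
    exact ⟨i, x, rfl⟩

theorem BFEquiv.zSum {α : Ordinal.{0}} {M M' : ℤ → Type} {K : Type} [∀ n, LinearOrder (M n)]
    [∀ n, LinearOrder (M' n)] [LinearOrder K] (s : ℤ)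
    (h : ∀ n, BFEquiv α (M n) (M' (n + s))) : BFEquiv α (ZSum M K) (ZSum M' K) :=
  (isOrderedSum_sigma fun n => Block (M n) K).bfEquiv
    (isOrderedSum_sigma_add (fun n => Block (M' n) K) s)
    fun n => (refl α Unit).sumLex ((h n).sumLex ((refl α Unit).sumLex (refl α K)))

/-! ## Preservation of infinitary formulas -/

theorem exists_term_eq_var {n : ℕ} (t : Language.order.Term (Empty ⊕ Fin n)) :
    ∃ i : Fin n, t = .var (Sum.inr i) := by
  rcases t with ⟨x | i⟩ | ⟨f, _⟩
  · exact x.elim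
  · exact ⟨i, rfl⟩
  · exact f.elim

theorem realize_iff_of_isQF {M N : Type} [LinearOrder M] [LinearOrder N] {n : ℕ}
    {a : Fin n → M} {b : Fin n → N} (h : ∀ i j, a i ≤ a j ↔ b i ≤ b j)
    {φ : Language.order.BoundedFormula Empty n} (hφ : φ.IsQF) :
    letI : Language.order.Structure M := Language.orderStructure M
    letI : Language.order.Structure N := Language.orderStructure N
    (φ.Realize Empty.elim a ↔ φ.Realize Empty.elim b) := by
  let : Language.order.Structure M := Language.orderStructure M
  let : Language.order.Structure N := Language.orderStructure N
  induction hφ with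
  | falsum => rfl
  | of_isAtomic hψ =>
    rcases hψ with ⟨t₁, t₂⟩ | ⟨R, ts⟩
    · obtain ⟨i, rfl⟩ := exists_term_eq_var t₁
      obtain ⟨j, rfl⟩ := exists_term_eq_var t₂
      simp [Language.BoundedFormula.realize_bdEqual, le_antisymm_iff, h]
    · cases R
      obtain ⟨i, hi⟩ := exists_term_eq_var (ts 0)
      obtain ⟨j, hj⟩ := exists_term_eq_var (ts 1)
      change Language.Term.realize _ (ts 0) ≤ Language.Term.realize _ (ts 1) ↔
        Language.Term.realize _ (ts 0) ≤ Language.Term.realize _ (ts 1)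
      rw [hi, hj]
      exact h i j
  | imp _ _ h₁ h₂ => exact imp_congr h₁ h₂

theorem InfFormula.HasComplexity.mono {n : ℕ} {φ : InfFormula n} {s : Side} {α β : Ordinal.{0}}
    (h : φ.HasComplexity s α) (hαβ : α ≤ β) : φ.HasComplexity s β := by
  cases φ <;> cases s
  · trivial
  · trivial
  · exact fun i => (h i).imp fun _ hi => ⟨hi.1.trans_le hαβ, hi.2⟩
  · exact h.elim
  · exact h.elim
  · exact fun i => (h i).imp fun _ hi => ⟨hi.1.trans_le hαβ, hi.2⟩

/-- If `a ≤_α b`, then `Π_α` formulas pass from `a` to `b` and `Σ_α` formulas from `b` to `a`. -/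
theorem BFLE.realize {n : ℕ} (φ : InfFormula n) {α : Ordinal.{0}} {M N : Type} [LinearOrder M]
    [LinearOrder N] {a : Fin n → M} {b : Fin n → N} (h : BFLE α a b) :
    (φ.HasComplexity .pi α → φ.Realize a → φ.Realize b) ∧
      (φ.HasComplexity .sigma α → φ.Realize b → φ.Realize a) := by
  induction φ generalizing α M N with
  | qf φ hφ =>
    exact ⟨fun _ => (realize_iff_of_isQF h.le_iff_le hφ).1,
      fun _ => (realize_iff_of_isQF h.le_iff_le hφ).2⟩
  | disjEx k φ ih =>
    refine ⟨fun hc => hc.elim, fun hc => ?_⟩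
    rintro ⟨i, w, hw⟩
    obtain ⟨β, hβ, hi⟩ := hc i
    obtain ⟨c, hc⟩ := h.exists_extend hβ w
    exact ⟨i, c, (ih i hc).1 hi hw⟩
  | conjAll k φ ih =>
    refine ⟨fun hc hr i w => ?_, fun hc => hc.elim⟩
    obtain ⟨β, hβ, hi⟩ := hc i
    obtain ⟨c, hc⟩ := h.exists_extend hβ w
    exact (ih i hc).2 hi (hr i c)

/-- A `Π_α` sentence passes along `≤_α`, so one direction of back-and-forth suffices. Countability
is needed because a Scott sentence only controls countable models. -/
theorem IsScottSentence.nonempty_orderIso {φ : InfFormula 0} {K M N : Type} [LinearOrder K]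
    [LinearOrder M] [LinearOrder N] [Countable M] [Countable N] {α : Ordinal.{0}}
    (hφ : IsScottSentence φ K) (hc : φ.HasComplexity .pi α)
    (h : BFLE α (Fin.elim0 : Fin 0 → M) (Fin.elim0 : Fin 0 → N)) (e : Nonempty (M ≃o K)) :
    Nonempty (N ≃o K) :=
  (hφ N).1 ((h.realize φ).1 hc ((hφ M).2 e))

theorem BFLE.exists_tuple {M N : Type} [LinearOrder M] [LinearOrder N] {α β : Ordinal.{0}}
    (h : BFLE α (Fin.elim0 : Fin 0 → M) (Fin.elim0 : Fin 0 → N)) (hβ : β < α) {k : ℕ}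
    (d : Fin k → N) : ∃ c : Fin k → M, BFLE β d c := by
  obtain ⟨c, hc⟩ := h.exists_extend hβ d
  refine ⟨c, ?_⟩
  have := hc.comp (Fin.natAdd 0)
  convert this using 1 <;>
  · ext t
    exact (Fin.append_right _ _ t).symm

/-! ## Marked orders -/

/-- `A` is cut by points `⋯ < u i < v i < u (i + 1) < v (i + 1) < ⋯` such that the intervals
`(v i, u (i + 1))` are the maximal open intervals isomorphic to `K`. -/
structure IsMarked (K : Type) [LinearOrder K] {A : Type} [LinearOrder A] (u v : ℤ → A) :
    Prop where
  u_lt_v : ∀ i, u i < v i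
  v_lt_u : ∀ i, v i < u (i + 1)
  iso : ∀ i, Nonempty (Set.Ioo (v i) (u (i + 1)) ≃o K)
  delim : ∀ x y, Nonempty (Set.Ioo x y ≃o K) → ∃ q, v q ≤ x ∧ y ≤ u (q + 1)

namespace IsMarked

variable {K : Type} [LinearOrder K] {A : Type} [LinearOrder A] {u v : ℤ → A}

theorem strictMono_u (h : IsMarked K u v) : StrictMono u :=
  strictMono_int_of_lt_succ fun i => (h.u_lt_v i).trans (h.v_lt_u i)

theorem strictMono_v (h : IsMarked K u v) : StrictMono v :=
  strictMono_int_of_lt_succ fun i => (h.v_lt_u i).trans (h.u_lt_v (i + 1))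

theorem u_lt_v_iff (h : IsMarked K u v) {i j : ℤ} : u i < v j ↔ i ≤ j := by
  refine ⟨fun hij => ?_, fun hij => (h.strictMono_u.monotone hij).trans_lt (h.u_lt_v j)⟩
  by_contra! hji
  exact ((h.v_lt_u j).trans_le (h.strictMono_u.monotone hji)).not_gt hij

end IsMarked

theorem lt_of_orderIso_Ioo {K A : Type} [LinearOrder K] [Nonempty K] [LinearOrder A] {x y : A}
    (e : Nonempty (Set.Ioo x y ≃o K)) : x < y := by
  obtain ⟨e⟩ := e
  obtain ⟨k⟩ := ‹Nonempty K›
  exact (e.symm k).2.1.trans (e.symm k).2.2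

section Marked

variable {K A B : Type} [LinearOrder K] [LinearOrder A] [LinearOrder B]
  [Countable A] [Countable B] {φ : InfFormula 0} {γ : Ordinal.{0}} {n : ℕ} {a : Fin n → A}
  {b : Fin n → B} {u v : ℤ → A} {U V : ℤ → B}

/-- One level is spent on playing the endpoints `x`, `y`. The interval between the answers is then
again a copy of `K`, in the same position relative to the distinguished tuple. -/
theorem BFLE.exists_Ioo_iso (hφ : IsScottSentence φ K) (hc : φ.HasComplexity .pi γ)
    (h : BFLE (γ + 1) a b) {x y : B} (e : Nonempty (Set.Ioo x y ≃o K)) :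
    ∃ x' y' : A, Nonempty (Set.Ioo x' y' ≃o K) ∧
      (∀ i, (b i ≤ x ↔ a i ≤ x') ∧ (x ≤ b i ↔ x' ≤ a i)) ∧
      ∀ i, (b i ≤ y ↔ a i ≤ y') ∧ (y ≤ b i ↔ y' ≤ a i) := by
  obtain ⟨c, h'⟩ := h.exists_extend (Order.lt_add_one_iff.2 le_rfl) ![x, y]
  have h0 := h'.Ioo (Fin.append_right b ![x, y] 0) (Fin.append_right b ![x, y] 1)
    (Fin.append_right a c 0) (Fin.append_right a c 1)
  have hl := fun i t => h'.le_iff_le (Fin.castAdd 2 i) (Fin.natAdd n t)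
  have hr := fun i t => h'.le_iff_le (Fin.natAdd n t) (Fin.castAdd 2 i)
  simp only [Fin.append_left, Fin.append_right] at hl hr
  exact ⟨c 0, c 1, hφ.nonempty_orderIso hc h0 e, fun i => ⟨hl i 0, hr i 0⟩,
    fun i => ⟨hl i 1, hr i 1⟩⟩

/-- The interval `(b i, b j)` is a copy of `K`, hence inside some delimiter of `B`. Pulling that
whole delimiter back to `A` gives a copy of `K` containing the maximal one `(v p, u (p + 1))`, so
nothing was gained and the endpoints agree. -/
theorem IsMarked.exists_eq_of_bfle (hA : IsMarked K u v) (hB : IsMarked K U V)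
    (hφ : IsScottSentence φ K) (hc : φ.HasComplexity .pi γ) (h : BFLE (γ + 1) a b)
    {i j : Fin n} {p : ℤ} (hi : a i = v p) (hj : a j = u (p + 1)) :
    ∃ q, b i = V q ∧ b j = U (q + 1) := by
  have e : Nonempty (Set.Ioo (b i) (b j) ≃o K) := by
    refine hφ.nonempty_orderIso hc ((h.mono le_self_add).Ioo hi hj rfl rfl) ?_
    exact hA.iso p
  obtain ⟨q, hq1, hq2⟩ := hB.delim _ _ e
  obtain ⟨x, y, e', hx, hy⟩ := h.exists_Ioo_iso hφ hc (hB.iso q)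
  obtain ⟨r, hr1, hr2⟩ := hA.delim _ _ e'
  have h1 := (hx i).2.1 hq1
  have h2 := (hy j).1.1 hq2
  rw [hi] at h1
  rw [hj] at h2
  have h3 := hA.strictMono_v.le_iff_le.1 (hr1.trans h1)
  have h4 := hA.strictMono_u.le_iff_le.1 (h2.trans hr2)
  obtain rfl : r = p := by omega
  exact ⟨q, ((hx i).1.2 (hi.trans_le hr1)).antisymm hq1,
    hq2.antisymm ((hy j).2.2 (hr2.trans_eq hj.symm))⟩

/-- If `q < r`, a whole delimiter of `B` lies between `U q` and `V r`. It would pull back to a copy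
of `K` inside `[u p, v p]`, where no delimiter of `A` reaches. -/
theorem IsMarked.eq_of_bfle [Nonempty K] (hA : IsMarked K u v) (hB : IsMarked K U V)
    (hφ : IsScottSentence φ K) (hc : φ.HasComplexity .pi γ) (h : BFLE (γ + 1) a b)
    {i j : Fin n} {p q r : ℤ} (hi : a i = u p) (hj : a j = v p) (hi' : b i = U q)
    (hj' : b j = V r) : q = r := by
  have h1 : U q < V r := by
    rw [← hi', ← hj', ← h.lt_iff_lt, hi, hj]
    exact hA.u_lt_v p
  refine (hB.u_lt_v_iff.1 h1).antisymm ?_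
  by_contra! hlt
  obtain ⟨x, y, e, hx, hy⟩ := h.exists_Ioo_iso hφ hc (hB.iso q)
  obtain ⟨t, ht1, ht2⟩ := hA.delim _ _ e
  have hxy := lt_of_orderIso_Ioo e
  have h2 := (hx i).1.1 (hi'.trans_le (hB.u_lt_v q).le)
  have h3 := (hy j).2.1 (by rw [hj']; exact (hB.u_lt_v_iff.2 (by omega)).le)
  rw [hi] at h2
  rw [hj] at h3
  have h4 := hA.strictMono_u.lt_iff_lt.1 (h2.trans_lt (hxy.trans_le ht2))
  have h5 := hA.strictMono_v.lt_iff_lt.1 (ht1.trans_lt (hxy.trans_le h3))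
  omega

/-- A sufficiently strong back-and-forth equivalence between marked orders matches windows of
consecutive intervals `(u i, v i)`. -/
theorem IsMarked.exists_shift [Nonempty K] (hA : IsMarked K u v) (hB : IsMarked K U V)
    (hφ : IsScottSentence φ K) (hc : φ.HasComplexity .pi γ)
    (h : BFLE (γ + 1 + 1) (Fin.elim0 : Fin 0 → B) (Fin.elim0 : Fin 0 → A)) (m : ℕ) :
    ∃ s : ℤ, ∀ i : ℕ, i < m →
      BFLE (γ + 1) (Fin.elim0 : Fin 0 → Set.Ioo (u i) (v i))
        (Fin.elim0 : Fin 0 → Set.Ioo (U (i + s)) (V (i + s))) := by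
  -- The challenge consists of the endpoints of the `m + 1` delimiters that bound the `m` intervals
  -- `(u i, v i)`; the first delimiter precedes `u 0`, hence `v (i - 1)`.
  obtain ⟨c, h'⟩ := h.exists_tuple (Order.lt_add_one_iff.2 le_rfl)
    (Fin.append (fun i : Fin (m + 1) => v ((i : ℤ) - 1)) (fun i : Fin (m + 1) => u (i : ℤ)))
  have hex : ∀ i : ℕ, ∃ q, ∀ hi : i < m + 1, c (Fin.castAdd _ ⟨i, hi⟩) = V q ∧
      c (Fin.natAdd _ ⟨i, hi⟩) = U (q + 1) := fun i => by
    by_cases hi : i < m + 1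
    · obtain ⟨q, hq⟩ := hA.exists_eq_of_bfle hB hφ hc h' (i := Fin.castAdd _ ⟨i, hi⟩)
        (j := Fin.natAdd _ ⟨i, hi⟩) (p := (i : ℤ) - 1)
        (Fin.append_left _ _ _) ((Fin.append_right _ _ _).trans (by simp))
      exact ⟨q, fun _ => hq⟩
    · exact ⟨0, fun hi' => absurd hi' hi⟩
  choose q hq using hex
  have hstep : ∀ i, i < m → q i + 1 = q (i + 1) := fun i hi =>
    hA.eq_of_bfle hB hφ hc h' (i := Fin.natAdd _ ⟨i, by omega⟩)
      (j := Fin.castAdd _ ⟨i + 1, by omega⟩) (p := i)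
      (Fin.append_right _ _ _) ((Fin.append_left _ _ _).trans (by simp))
      (hq i (by omega)).2 (hq (i + 1) (by omega)).1
  have hq0 : ∀ i, i ≤ m → q i = i + q 0 := fun i => by
    induction i with
    | zero => simp
    | succ i ih =>
      intro hi
      rw [← hstep i hi, ih (by omega)]
      push_cast
      ring
  -- The delimiter ending at `u 0` is answered by the one ending at `U (q 0 + 1)`.
  refine ⟨q 0 + 1, fun i hi => ?_⟩
  refine h'.Ioo (i := Fin.natAdd _ ⟨i, by omega⟩) (j := Fin.castAdd _ ⟨i + 1, by omega⟩)
    (Fin.append_right _ _ _) ((Fin.append_left _ _ _).trans (by simp)) ?_ ?_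
  · rw [(hq i (by omega)).2, hq0 i hi.le, add_assoc]
  · rw [(hq (i + 1) (by omega)).1, ← hstep i hi, hq0 i hi.le, add_assoc]

end Marked

/-! ## The `ℤ`-sum as a marked order -/

section ZSum

variable {M : ℤ → Type} {K : Type} [∀ n, LinearOrder (M n)] [LinearOrder K]

/-- The first point of the `n`-th block of a `ℤ`-sum. -/
def ZSum.left (M : ℤ → Type) (K : Type) (n : ℤ) : ZSum M K := toLex ⟨n, Sum.inlₗ ()⟩

/-- The point between `M n` and the following copy of `K` in a `ℤ`-sum. -/
def ZSum.right (M : ℤ → Type) (K : Type) (n : ℤ) : ZSum M K :=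
  toLex ⟨n, Sum.inrₗ (Sum.inrₗ (Sum.inlₗ ()))⟩

theorem ZSum.lt_iff {n m : ℤ} {x : Block (M n) K} {y : Block (M m) K} :
    (toLex ⟨n, x⟩ : ZSum M K) < toLex ⟨m, y⟩ ↔ n < m ∨ ∃ h : n = m, h ▸ x < y :=
  Sigma.Lex.lt_def

theorem ZSum.mk_lt_mk {n : ℤ} {x y : Block (M n) K} :
    (toLex ⟨n, x⟩ : ZSum M K) < toLex ⟨n, y⟩ ↔ x < y := by
  simp [ZSum.lt_iff]

theorem nonempty_orderIso_of_range_eq {X S : Type} [LinearOrder X] [LinearOrder S] {e : X → S}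
    (he : StrictMono e) {s : Set S} (h : Set.range e = s) : Nonempty (s ≃o X) := by
  subst h
  exact ⟨he.orderIso.symm⟩

theorem ZSum.nonempty_Ioo_left_right (n : ℤ) :
    Nonempty (Set.Ioo (ZSum.left M K n) (ZSum.right M K n) ≃o M n) := by
  refine nonempty_orderIso_of_range_eq
    (e := fun x => (toLex ⟨n, Sum.inrₗ (Sum.inlₗ x)⟩ : ZSum M K)) ?_ ?_
  · intro x y h
    rw [ZSum.mk_lt_mk]
    simpa using h
  · ext ⟨m, x⟩
    constructor
    · rintro ⟨y, hy⟩
      rw [← hy]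
      exact ⟨ZSum.mk_lt_mk.2 (by simp), ZSum.mk_lt_mk.2 (by simp)⟩
    · rintro ⟨h1, h2⟩
      obtain rfl : m = n := by
        rcases ZSum.lt_iff.1 h1 with h1 | ⟨h1, -⟩ <;>
        rcases ZSum.lt_iff.1 h2 with h2 | ⟨h2, -⟩ <;> omega
      have h1 := ZSum.mk_lt_mk.1 h1
      have h2 := ZSum.mk_lt_mk.1 h2
      rcases x with _ | x | _ | x
      · exact absurd h1 (lt_irrefl _)
      · exact ⟨x, rfl⟩
      · exact absurd h2 (lt_irrefl _)
      · exact (Sum.Lex.not_inr_lt_inl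
          (Sum.Lex.inr_lt_inr_iff.1 (Sum.Lex.inr_lt_inr_iff.1 h2))).elim

theorem ZSum.nonempty_Ioo_right_left (n : ℤ) :
    Nonempty (Set.Ioo (ZSum.right M K n) (ZSum.left M K (n + 1)) ≃o K) := by
  refine nonempty_orderIso_of_range_eq
    (e := fun x => (toLex ⟨n, Sum.inrₗ (Sum.inrₗ (Sum.inrₗ x))⟩ : ZSum M K)) ?_ ?_
  · intro x y h
    rw [ZSum.mk_lt_mk]
    simpa using h
  · ext ⟨m, x⟩
    constructor
    · rintro ⟨y, hy⟩
      rw [← hy]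
      exact ⟨ZSum.mk_lt_mk.2 (by simp), ZSum.lt_iff.2 (.inl (lt_add_one n))⟩
    · rintro ⟨h1, h2⟩
      have hmn : m = n ∨ m = n + 1 := by
        rcases ZSum.lt_iff.1 h1 with h1 | ⟨h1, -⟩ <;>
        rcases ZSum.lt_iff.1 h2 with h2 | ⟨h2, -⟩ <;> omega
      rcases hmn with rfl | rfl
      · have h1 := ZSum.mk_lt_mk.1 h1
        rcases x with _ | x | _ | x
        · exact (Sum.Lex.not_inr_lt_inl h1).elim
        · exact (Sum.Lex.not_inr_lt_inl (Sum.Lex.inr_lt_inr_iff.1 h1)).elim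
        · exact absurd h1 (lt_irrefl _)
        · exact ⟨x, rfl⟩
      · have h2 := ZSum.mk_lt_mk.1 h2
        rcases x with _ | x
        · exact absurd h2 (lt_irrefl _)
        · exact (Sum.Lex.not_inr_lt_inl h2).elim

theorem ZSum.left_lt_right (n : ℤ) : ZSum.left M K n < ZSum.right M K n :=
  ZSum.mk_lt_mk.2 (by simp)

theorem ZSum.right_lt_left (n : ℤ) : ZSum.right M K n < ZSum.left M K (n + 1) :=
  ZSum.lt_iff.2 (.inl (lt_add_one n))

end ZSum

/-! ### Transfer of the delimiter condition from finite alternating sums to `ℤ`-sums -/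

section FinSum

variable {L : ℕ → Type} {K : Type}

/-- The inclusion of a finite alternating sum as a convex part of a `ℤ`-sum. -/
def FinSum.toZSum (s : ℤ → ℕ) (K : Type) (N : ℤ) (n : ℕ) :
    FinSum (fun j => L (s (N + j))) K n → ZSum (fun m => L (s m)) K
  | .inl ⟨j, x⟩ => toLex ⟨N + (j : ℕ), x⟩
  | .inr (.inl _) => ZSum.left _ K (N + n)
  | .inr (.inr x) => toLex ⟨N + n, Sum.inrₗ (Sum.inlₗ x)⟩

theorem FinSum.exists_toZSum_eq {s : ℤ → ℕ} {N : ℤ} {n : ℕ} {m : ℤ}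
    (x : Block (L (s m)) K) (h : N ≤ m) (h' : m < N + n) :
    ∃ y, FinSum.toZSum s K N n y = toLex ⟨m, x⟩ := by
  obtain ⟨j, rfl⟩ := Int.le.dest h
  exact ⟨Sum.inlₗ (toLex ⟨⟨j, by omega⟩, x⟩), rfl⟩

variable [∀ i, LinearOrder (L i)] [LinearOrder K]

theorem FinSum.toZSum_strictMono (s : ℤ → ℕ) (N : ℤ) (n : ℕ) :
    StrictMono (FinSum.toZSum (L := L) s K N n) := by
  rintro (⟨j, x⟩ | _ | x) (⟨k, y⟩ | _ | y) h
  · have h : (toLex ⟨j, x⟩ : Σₗ j : Fin n, Block (L (s (N + j))) K) < toLex ⟨k, y⟩ :=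
      Sum.Lex.inl_lt_inl_iff.1 h
    rcases Sigma.Lex.lt_def.1 h with h | ⟨h, h'⟩
    · refine ZSum.lt_iff.2 (.inl ?_)
      change j < k at h
      simpa using h
    · change j = k at h
      subst h
      exact ZSum.mk_lt_mk.2 h'
  · exact ZSum.lt_iff.2 (.inl (by simp))
  · exact ZSum.lt_iff.2 (.inl (by simp))
  · exact (Sum.Lex.not_inr_lt_inl h).elim
  · exact absurd h (lt_irrefl _)
  · exact ZSum.mk_lt_mk.2 (by simp)
  · exact (Sum.Lex.not_inr_lt_inl h).elim
  · exact (Sum.Lex.not_inr_lt_inl (Sum.Lex.inr_lt_inr_iff.1 h)).elim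
  · refine ZSum.mk_lt_mk.2 ?_
    have := Sum.Lex.inr_lt_inr_iff.1 (Sum.Lex.inr_lt_inr_iff.1 h)
    simpa using this

/-- An interval of the `ℤ`-sum meets only finitely many blocks, so it already lies in a finite
alternating sum, where the delimiter condition applies. -/
theorem IsMixablePair.zSum_delim {lam : Ordinal.{0}} {δ : ℕ → Ordinal.{0}}
    (hLK : IsMixablePair lam δ L K) (s : ℤ → ℕ) (a b : ZSum (fun m => L (s m)) K)
    (e : Nonempty (Set.Ioo a b ≃o K)) :
    ∃ q, ZSum.right _ K q ≤ a ∧ b ≤ ZSum.left _ K (q + 1) := by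
  have := hLK.nonempty_delim
  have hab := lt_of_orderIso_Ioo e
  obtain ⟨N, x, rfl⟩ : ∃ N x, a = toLex ⟨N, x⟩ := ⟨_, _, rfl⟩
  obtain ⟨N', y, rfl⟩ : ∃ N x, b = toLex ⟨N, x⟩ := ⟨_, _, rfl⟩
  have hN : N ≤ N' := by
    rcases ZSum.lt_iff.1 hab with h | ⟨h, -⟩ <;> omega
  -- All blocks from `N` to `N'` inclusive are taken whole, so neither endpoint can lie in the
  -- incomplete final `1 + L`.
  let n := (N' - N + 1).toNat
  have hn : (n : ℤ) = N' - N + 1 := Int.toNat_of_nonneg (by omega)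
  have hu := FinSum.toZSum_strictMono (L := L) (K := K) s N n
  obtain ⟨a', ha'⟩ := FinSum.exists_toZSum_eq (L := L) (K := K) (n := n) x le_rfl (by omega)
  obtain ⟨b', hb'⟩ := FinSum.exists_toZSum_eq (L := L) (K := K) (n := n) y hN (by omega)
  have hrange : ∀ z ∈ Set.Ioo (toLex ⟨N, x⟩ : ZSum (fun m => L (s m)) K) (toLex ⟨N', y⟩),
      ∃ z' ∈ Set.Ioo a' b', FinSum.toZSum s K N n z' = z := by
    rintro ⟨m, z⟩ ⟨h1, h2⟩
    have hm : N ≤ m ∧ m ≤ N' := by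
      rcases ZSum.lt_iff.1 h1 with h1' | ⟨h1', -⟩ <;>
      rcases ZSum.lt_iff.1 h2 with h2' | ⟨h2', -⟩ <;> omega
    obtain ⟨z', hz'⟩ := FinSum.exists_toZSum_eq (L := L) (K := K) (n := n) z hm.1 (by omega)
    exact ⟨z', ⟨hu.lt_iff_lt.1 (by rw [ha', hz']; exact h1),
      hu.lt_iff_lt.1 (by rw [hb', hz']; exact h2)⟩, hz'⟩
  obtain ⟨e'⟩ : Nonempty (Set.Ioo (toLex ⟨N, x⟩ : ZSum (fun m => L (s m)) K) (toLex ⟨N', y⟩) ≃o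
      Set.Ioo a' b') := by
    refine nonempty_orderIso_of_range_eq
      (e := fun z : Set.Ioo a' b' => FinSum.toZSum s K N n z) (fun _ _ h => hu h) ?_
    ext z
    constructor
    · rintro ⟨z', rfl⟩
      rw [← ha', ← hb']
      exact ⟨hu z'.2.1, hu z'.2.2⟩
    · intro hz
      obtain ⟨z', h, rfl⟩ := hrange z hz
      exact ⟨⟨z', h⟩, rfl⟩
  obtain ⟨e⟩ := e
  obtain ⟨j, hj⟩ := hLK.delim n (fun j => s (N + j)) a' b' ⟨e'.symm.trans e⟩
  have hblock : ∀ z ∈ Set.Ioo (toLex ⟨N, x⟩ : ZSum (fun m => L (s m)) K) (toLex ⟨N', y⟩),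
      ∃ k : K, z = toLex ⟨N + (j : ℕ), Sum.inrₗ (Sum.inrₗ (Sum.inrₗ k))⟩ := by
    intro z hz
    obtain ⟨z', h, rfl⟩ := hrange z hz
    obtain ⟨k, rfl⟩ := hj h
    exact ⟨k, rfl⟩
  obtain ⟨z⟩ : Nonempty (Set.Ioo (toLex ⟨N, x⟩ : ZSum (fun m => L (s m)) K) (toLex ⟨N', y⟩)) :=
    ⟨e.symm hLK.nonempty_delim.some⟩
  obtain ⟨k, hk⟩ := hblock z z.2
  have hzl : ZSum.right (fun m => L (s m)) K (N + (j : ℕ)) < z := by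
    rw [hk]
    exact ZSum.mk_lt_mk.2 (by simp)
  have hzr : z < ZSum.left (fun m => L (s m)) K (N + (j : ℕ) + 1) := by
    rw [hk]
    exact ZSum.lt_iff.2 (.inl (lt_add_one _))
  -- If a bound failed, the point adjacent to the `K` block would lie between an endpoint and `z`,
  -- hence in the interval, although it is not in the `K` block.
  refine ⟨N + (j : ℕ), ?_, ?_⟩
  · by_contra! h
    obtain ⟨k', hk'⟩ := hblock _ ⟨h, hzl.trans z.2.2⟩
    simp [ZSum.right] at hk'
  · by_contra! h
    obtain ⟨k', hk'⟩ := hblock _ ⟨z.2.1.trans hzr, h⟩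
    simp [ZSum.left] at hk'

theorem IsMixablePair.isMarked_zSum {lam : Ordinal.{0}} {δ : ℕ → Ordinal.{0}}
    (hLK : IsMixablePair lam δ L K) (s : ℤ → ℕ) :
    IsMarked K (ZSum.left (fun m => L (s m)) K) (ZSum.right (fun m => L (s m)) K) where
  u_lt_v := ZSum.left_lt_right
  v_lt_u := ZSum.right_lt_left
  iso := ZSum.nonempty_Ioo_right_left
  delim := hLK.zSum_delim s

end FinSum

/-! ### The two directions of the equivalence -/

section Mixable

variable {lam : Ordinal.{0}} {δ : ℕ → Ordinal.{0}} {L : ℕ → Type} {K : Type}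
  [∀ i, LinearOrder (L i)] [LinearOrder K]

theorem IsMixablePair.bfEquiv_of_le (hLK : IsMixablePair lam δ L K) {l i j : ℕ} (hi : l ≤ i)
    (hj : l ≤ j) : BFEquiv (δ l) (L i) (L j) := by
  have key : ∀ i, l ≤ i → BFEquiv (δ l) (L l) (L i) := fun i hi => by
    induction i, hi using Nat.le_induction with
    | base => exact .refl _ _
    | succ i hi ih =>
      exact ih.trans ((hLK.equiv_succ i).mono (hLK.fundamental.strictMono.monotone hi))
  exact (key i hi).symm.trans (key j hj)

/-- If `i < j` and `i < l`, then `L i ≡ L j ≡ L (i + 1)` at level `δ (i + 1)`, which the mixable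
pair forbids. -/
theorem IsMixablePair.min_eq_of_bfEquiv (hLK : IsMixablePair lam δ L K) {l i j : ℕ}
    (h : BFEquiv (δ l) (L i) (L j)) : min l i = min l j := by
  wlog hij : i ≤ j generalizing i j
  · exact (this h.symm (by omega)).symm
  by_contra hne
  have hi : i + 1 ≤ l := by omega
  exact hLK.not_equiv_succ i
    ((h.mono (hLK.fundamental.strictMono.monotone hi)).trans
      (hLK.bfEquiv_of_le (by omega) le_rfl))

theorem coe_toNat_trunc (l : ℕ) (f : ℤ → ℕ∞) (m : ℤ) :
    ((trunc l f m).toNat : ℕ∞) = trunc l f m :=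
  ENat.natCast_toNat (ne_top_of_le_ne_top (ENat.natCast_ne_top l) (min_le_left _ _))

/-- An `(f, ℤ)`-sum is `≡_{δ l}` to the sum without limit structures given by `min(l, f)`. -/
theorem IsZSum.bfEquiv_trunc (hLK : IsMixablePair lam δ L K) {f : ℤ → ℕ∞} {S : Type}
    [LinearOrder S] (hS : IsZSum δ L K f S) (l : ℕ) :
    BFEquiv (δ l) S (ZSum (fun m => L (trunc l f m).toNat) K) := by
  obtain ⟨M, _, hfin, hlim, ⟨e⟩⟩ := hS
  refine (BFEquiv.of_orderIso e).trans
    (.sigma fun m => (BFEquiv.refl _ _).sumLex (.sumLex ?_ (.refl _ _)))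
  cases hm : f m with
  | top =>
    obtain ⟨-, h⟩ := hlim m hm
    obtain ⟨i, hi, h⟩ := h l
    exact h.trans (hLK.bfEquiv_of_le hi (by simp [trunc, hm]))
  | coe i =>
    obtain ⟨e⟩ := hfin m i hm
    refine (BFEquiv.of_orderIso e).trans ?_
    have hj : (trunc l f m).toNat = min l i := by
      rw [trunc, hm, ← Nat.mono_cast.map_min, ENat.toNat_natCast]
    -- The index is generalised because the type `L j` and its order depend on it.
    have key : ∀ j, j = min l i → BFEquiv (δ l) (L i) (L j) := by
      rintro j rfl
      rcases le_total l i with h | h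
      · exact hLK.bfEquiv_of_le h (by simp [h])
      · rw [min_eq_right h]
        exact .refl _ _
    exact key _ hj

/-- The relation at `lam` only asks about `β < lam`, and each such `β` lies below some `δ l`. -/
theorem BFLE.of_forall_fundamental (hδ : IsFundamentalSeq δ lam) {S T : Type} [LinearOrder S]
    [LinearOrder T] {n : ℕ} {a : Fin n → S} {b : Fin n → T} (h : ∀ l, BFLE (δ l) a b) :
    BFLE lam a b := by
  refine bfle_iff.2 ⟨(h 0).le_iff_le, fun β hβ k d => ?_⟩
  obtain ⟨_, ⟨l, rfl⟩, hl⟩ := (lt_isLUB_iff hδ.isLUB).1 hβ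
  exact (h l).exists_extend hl d

theorem IsMixablePair.bfEquiv_of_eFin (hLK : IsMixablePair lam δ L K) {f g : ℤ → ℕ∞}
    {S T : Type} [LinearOrder S] [LinearOrder T] (hS : IsZSum δ L K f S)
    (hT : IsZSum δ L K g T) (h : EFin f g) : BFEquiv lam S T := by
  have key : ∀ l, BFEquiv (δ l) S T := fun l => by
    obtain ⟨s, hs⟩ := h l
    refine ((hS.bfEquiv_trunc hLK l).trans (.zSum s fun n => ?_)).trans
      (hT.bfEquiv_trunc hLK l).symm
    rw [hs n]
    exact .refl _ _
  exact ⟨.of_forall_fundamental hLK.fundamental fun l => (key l).1,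
    .of_forall_fundamental hLK.fundamental fun l => (key l).2⟩

/-- The product `p * q` is a common period, so agreement on one window of that length propagates to
all of `ℤ`. -/
theorem shiftEquiv_of_window {f g : ℤ → ℕ∞} {p q s : ℤ} (hp : 0 < p) (hq : 0 < q)
    (hf : Function.Periodic f p) (hg : Function.Periodic g q)
    (h : ∀ i : ℕ, i < (p * q).toNat → f i = g (i + s)) : ShiftEquiv f g := by
  refine ⟨s, fun m => ?_⟩
  have hpq : 0 < p * q := mul_pos hp hq
  have hf' : Function.Periodic f (p * q) := by
    rw [mul_comm]
    exact hf.int_mul q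
  have hg' : Function.Periodic g (p * q) := hg.int_mul p
  have h0 := Int.emod_nonneg m hpq.ne'
  have h1 := Int.emod_lt_of_pos m hpq
  have h2 := h (m % (p * q)).toNat (by omega)
  rw [Int.toNat_of_nonneg h0] at h2
  have h3 := hf'.int_mul (m / (p * q)) (m % (p * q))
  have h4 := hg'.int_mul (m / (p * q)) (m % (p * q) + s)
  have h5 : m % (p * q) + m / (p * q) * (p * q) = m := by
    rw [mul_comm (m / _), Int.emod_add_mul_ediv]
  rw [add_right_comm, Int.cast_id, h5] at h4
  rw [Int.cast_id, h5] at h3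
  rw [h3, h2, h4]

theorem IsMixablePair.eFin_of_bfEquiv (hLK : IsMixablePair lam δ L K) {f g : ℤ → ℕ∞}
    (hf : ∀ l, IsPeriodic (trunc l f)) (hg : ∀ l, IsPeriodic (trunc l g))
    {S T : Type} [LinearOrder S] [LinearOrder T] (hS : IsZSum δ L K f S)
    (hT : IsZSum δ L K g T) (h : BFEquiv lam S T) : EFin f g := by
  intro l
  have := hLK.nonempty_delim
  have := hLK.countable_delim
  have := hLK.countable_seq
  obtain ⟨α, hα, φ, hc, hφ⟩ := hLK.rank_delim
  have hlt : ∀ i, δ i < lam := fun i =>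
    (hLK.fundamental.strictMono (Nat.lt_succ_self i)).trans_le
      (hLK.fundamental.isLUB.1 ⟨i + 1, rfl⟩)
  -- Level `γ` evaluates the Scott sentence of `K` and detects indices up to truncation at `l`. Two
  -- further levels pay for playing the delimiters and for pulling one back.
  let γ := max (α + 1) (δ l)
  have hγlam : γ + 1 + 1 < lam := by
    have h1 : γ < lam := max_lt (hLK.isSuccLimit.add_one_lt hα) (hlt l)
    exact hLK.isSuccLimit.add_one_lt (hLK.isSuccLimit.add_one_lt h1)
  obtain ⟨_, ⟨n, rfl⟩, hn⟩ := (lt_isLUB_iff hLK.fundamental.isLUB).1 hγlam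
  obtain ⟨N, hN, hlN⟩ : ∃ N, γ + 1 + 1 ≤ δ N ∧ l ≤ N :=
    ⟨max n l, hn.le.trans (hLK.fundamental.strictMono.monotone (le_max_left _ _)),
      le_max_right _ _⟩
  -- Truncating at `N` removes the limit structures, about which the delimiter condition says
  -- nothing. As `l ≤ N`, the truncation at `l` is not affected.
  have hAB := ((hS.bfEquiv_trunc hLK N).symm.trans (h.mono (hlt N).le)).trans
    (hT.bfEquiv_trunc hLK N)
  obtain ⟨p, hp, hfp⟩ := hf l
  obtain ⟨q, hq, hgq⟩ := hg l
  have hpi : φ.HasComplexity .pi γ := hc.mono (le_max_left _ _)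
  have hcount : ∀ s : ℤ → ℕ, Countable (ZSum (fun m => L (s m)) K) := fun s =>
    inferInstanceAs (Countable (Σ m : ℤ, Unit ⊕ (L (s m) ⊕ (Unit ⊕ K))))
  obtain ⟨s, hs⟩ := (hLK.isMarked_zSum fun m => (trunc N f m).toNat).exists_shift (A := ZSum (fun m => L (trunc N f m).toNat) K)
    (B := ZSum (fun m => L (trunc N g m).toNat) K)
    (hLK.isMarked_zSum fun m => (trunc N g m).toNat) hφ hpi (hAB.2.mono hN) (p * q).toNat
  have htrunc : ∀ (k : ℤ → ℕ∞) m, trunc l k m = (min l (trunc N k m).toNat : ℕ) := fun k m => by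
    rw [Nat.mono_cast.map_min, coe_toNat_trunc, trunc, trunc, ← min_assoc,
      min_eq_left (Nat.mono_cast hlN)]
  refine shiftEquiv_of_window (s := s) hp hq hfp hgq fun i hi => ?_
  rw [htrunc, htrunc]
  congr 1
  refine hLK.min_eq_of_bfEquiv ?_
  obtain ⟨e⟩ := ZSum.nonempty_Ioo_left_right (M := fun m => L (trunc N f m).toNat) (K := K) i
  obtain ⟨e'⟩ := ZSum.nonempty_Ioo_left_right (M := fun m => L (trunc N g m).toNat) (K := K)
    (i + s)
  -- The window relation is one-sided at level `γ + 1`, hence two-sided at level `γ`.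
  have hI : BFEquiv γ _ _ := ⟨(hs i hi).mono le_self_add,
    (hs i hi).symm_of_lt (Order.lt_add_one_iff.2 le_rfl)⟩
  exact (((BFEquiv.of_orderIso e.symm).trans hI).trans (.of_orderIso e')).mono (le_max_right _ _)

end Mixable

end ZSumTransfer

theorem proposition5p6 (lam : Ordinal.{0}) (δ : ℕ → Ordinal.{0}) (L : ℕ → Type) (K : Type)
    [∀ i, LinearOrder (L i)] [LinearOrder K]
    (hLK : ZSumTransfer.IsMixablePair lam δ L K)
    (f g : ℤ → ℕ∞)
    (hf : ZSumTransfer.AlmostPeriodic f) (hg : ZSumTransfer.AlmostPeriodic g)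
    (S T : Type) [LinearOrder S] [LinearOrder T]
    (hS : ZSumTransfer.IsZSum δ L K f S) (hT : ZSumTransfer.IsZSum δ L K g T) :
    ZSumTransfer.BFEquiv lam S T ↔ ZSumTransfer.EFin f g :=
  ⟨hLK.eFin_of_bfEquiv hf.2 hg.2 hS hT, hLK.bfEquiv_of_eFin hS hT⟩
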